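/- Let $\Lambda$ be the $\mathbb{Q}$-algebra of symmetric functions in countably many variables $x_1,x_2,\dots$, i.e. of the formal power series of bounded degree over $\mathbb{Q}$ that are invariant under all permutations of the variables. Let $p_n=\sum_i x_i^n$ ($n\ge 1$) be the power sums and $h_n=\sum_{i_1\le\cdots\le i_n}x_{i_1}\cdots x_{i_n}$ ($n\ge 0$) the complete homogeneous symmetric functions, with $h_0=1$ and $h_n=0$ for $n<0$. For a partition $\lambda=(\lambda_1\ge\cdots\ge\lambda_k>0)$, the universal symplectic and orthogonal Schur functions are $$sp_\lambda=\tfrac12\det\big(h_{\lambda_i-i+j}+h_{\lambda_i-i-j+2}\big)_{1\le i,j\le k}\quad(k\ge 1),\qquad o_\lambda=\det\big(h_{\lambda_i-i+j}-h_{\lambda_i-i-j}\big)_{1\le i,j\le k},$$ and $sp_\emptyset=o_\emptyset=1$ for the empty partition. **Theorem.** There is a unique $\mathbb{Q}$-algebra homomorphism $\omega:\Lambda\to\Lambda$ with $\omega(p_n)=(-1)^{n-1}p_n$ for all $n\ge1$; it is an involution, and for every partition $\lambda$ $$\omega(sp_\lambda)=o_{\lambda'},$$ where $\lambda'$ is the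 conjugate partition of $\lambda$. -/

import Mathlib

noncomputable section

namespace SymFun

/-- A formal power series over `ℚ` in the countably many variables `x₀, x₁, x₂, …` is symmetric if
it is fixed by every permutation of the variables. -/
def IsSymmetric (f : MvPowerSeries ℕ ℚ) : Prop :=
  ∀ σ : Equiv.Perm ℕ, MvPowerSeries.renameEquiv ℚ σ f = f

/-- A formal power series has bounded degree if the degrees of its monomials are bounded. -/
def HasBoundedDegree (f : MvPowerSeries ℕ ℚ) : Prop :=
  ∃ d : ℕ, ∀ m : ℕ →₀ ℕ, d < m.degree → MvPowerSeries.coeff m f = 0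

/-- A series is symmetric iff its coefficients are invariant under permuting the exponents. -/
theorem isSymmetric_iff (f : MvPowerSeries ℕ ℚ) :
    IsSymmetric f ↔ ∀ (σ : Equiv.Perm ℕ) (m : ℕ →₀ ℕ),
      MvPowerSeries.coeff (m.embDomain σ.toEmbedding) f = MvPowerSeries.coeff m f := by
  have key : ∀ (σ : Equiv.Perm ℕ) (m : ℕ →₀ ℕ),
      MvPowerSeries.coeff (m.embDomain σ.toEmbedding) (MvPowerSeries.renameEquiv ℚ σ f) =
        MvPowerSeries.coeff m f := fun σ m =>
    MvPowerSeries.coeff_embDomain_rename σ.toEmbedding f m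
  constructor
  · intro h σ m
    have := key σ m
    rwa [h σ] at this
  · intro h σ
    ext m
    have hm : (m.embDomain σ.symm.toEmbedding).embDomain σ.toEmbedding = m := by
      ext i
      obtain ⟨j, rfl⟩ := σ.surjective i
      have h1 := Finsupp.embDomain_apply_self σ.toEmbedding (m.embDomain σ.symm.toEmbedding) j
      have h2 := Finsupp.embDomain_apply_self σ.symm.toEmbedding m (σ j)
      simp only [Equiv.coe_toEmbedding, Equiv.symm_apply_apply] at h1 h2
      rw [h1, h2]
    have h1 := key σ (m.embDomain σ.symm.toEmbedding)
    have h2 := h σ (m.embDomain σ.symm.toEmbedding)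
    rw [hm] at h1 h2
    rw [h1, h2]

/-- The ring `Λ` of symmetric functions over `ℚ` in countably many variables: the symmetric
formal power series of bounded degree. -/
def symmetricFunctions : Subalgebra ℚ (MvPowerSeries ℕ ℚ) where
  carrier := {f | IsSymmetric f ∧ HasBoundedDegree f}
  mul_mem' := by
    rintro f g ⟨hf, a, ha⟩ ⟨hg, b, hb⟩
    refine ⟨fun σ => by rw [map_mul, hf σ, hg σ], a + b, fun m hm => ?_⟩
    rw [MvPowerSeries.coeff_mul]
    refine Finset.sum_eq_zero fun x hx => ?_
    have hx' : x.1 + x.2 = m := by simpa using hx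
    have hd : x.1.degree + x.2.degree = m.degree := by rw [← hx', map_add]
    rcases lt_or_ge a x.1.degree with h | h
    · rw [ha _ h, zero_mul]
    · rw [hb _ (by omega), mul_zero]
  add_mem' := by
    rintro f g ⟨hf, a, ha⟩ ⟨hg, b, hb⟩
    refine ⟨fun σ => by rw [map_add, hf σ, hg σ], max a b, fun m hm => ?_⟩
    rw [map_add, ha _ (lt_of_le_of_lt (le_max_left _ _) hm),
      hb _ (lt_of_le_of_lt (le_max_right _ _) hm), add_zero]
  algebraMap_mem' := by
    intro r
    refine ⟨fun σ => AlgEquiv.commutes _ r, 0, fun m hm => ?_⟩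
    have hm0 : m ≠ 0 := by rintro rfl; simp at hm
    classical
    simp [MvPowerSeries.algebraMap_apply, MvPowerSeries.coeff_C, hm0]

/-- The complete homogeneous symmetric function `h_n` as a formal power series: the sum of all
monomials of degree `n`, i.e. `∑_{i₁ ≤ ⋯ ≤ i_n} x_{i₁} ⋯ x_{i_n}`. -/
def hseries (n : ℕ) : MvPowerSeries ℕ ℚ :=
  fun m => if m.degree = n then 1 else 0

open Classical in
/-- The power sum `p_n = ∑_i x_i ^ n` (for `n ≥ 1`) as a formal power series: the monomials
`x_i ^ n` have coefficient `1` and all other monomials have coefficient `0`. -/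
def pseries (n : ℕ) : MvPowerSeries ℕ ℚ :=
  fun m => if ∃ i : ℕ, m = Finsupp.single i n then 1 else 0

theorem coeff_hseries (n : ℕ) (m : ℕ →₀ ℕ) :
    MvPowerSeries.coeff m (hseries n) = if m.degree = n then 1 else 0 := rfl

open Classical in
theorem coeff_pseries (n : ℕ) (m : ℕ →₀ ℕ) :
    MvPowerSeries.coeff m (pseries n) = if ∃ i : ℕ, m = Finsupp.single i n then 1 else 0 := rfl

theorem hseries_mem (n : ℕ) : hseries n ∈ symmetricFunctions := by
  refine ⟨(isSymmetric_iff _).2 fun σ m => ?_, n, fun m hm => ?_⟩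
  · rw [coeff_hseries, coeff_hseries, Finsupp.embDomain_eq_mapDomain, Finsupp.degree_mapDomain]
  · rw [coeff_hseries, if_neg (by omega)]

theorem pseries_mem (n : ℕ) : pseries n ∈ symmetricFunctions := by
  refine ⟨(isSymmetric_iff _).2 fun σ m => ?_, n, fun m hm => ?_⟩
  · have : (∃ i : ℕ, m.embDomain σ.toEmbedding = Finsupp.single i n) ↔
        ∃ i : ℕ, m = Finsupp.single i n := by
      constructor
      · rintro ⟨i, hi⟩
        refine ⟨σ.symm i, Finsupp.embDomain_injective σ.toEmbedding ?_⟩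
        rw [hi, Finsupp.embDomain_single]
        exact congrArg (fun j => Finsupp.single j n) (σ.apply_symm_apply i).symm
      · rintro ⟨i, rfl⟩
        exact ⟨σ i, by rw [Finsupp.embDomain_single]; rfl⟩
    rw [coeff_pseries, coeff_pseries]
    by_cases hm : ∃ i : ℕ, m = Finsupp.single i n
    · rw [if_pos hm, if_pos (this.2 hm)]
    · rw [if_neg hm, if_neg (fun hc => hm (this.1 hc))]
  · rw [coeff_pseries, if_neg]
    rintro ⟨i, rfl⟩
    simp at hm

/-- The complete homogeneous symmetric function `h_n ∈ Λ` for `n : ℤ`, with `h_n = 0` for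
`n < 0`. -/
def h : ℤ → symmetricFunctions
  | Int.ofNat n => ⟨hseries n, hseries_mem n⟩
  | Int.negSucc _ => 0

/-- The power sum symmetric function `p_n ∈ Λ`; only used for `n ≥ 1`. -/
def p (n : ℕ) : symmetricFunctions := ⟨pseries n, pseries_mem n⟩

/-- The universal symplectic Schur function of a partition `lam = (lam_1, …, lam_k)` of length
`k ≥ 1`, namely `1/2 * det (h_{lam_i - i + j} + h_{lam_i - i - j + 2})_{1 ≤ i, j ≤ k}`, and `1` for
the empty partition. Partitions are Young diagrams, with `lam.rowLen i` the part `lam_{i+1}` and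
`lam.colLen 0` the length; the indices `i, j` below start at `0`. -/
def sp (lam : YoungDiagram) : symmetricFunctions :=
  if lam.colLen 0 = 0 then 1
  else (1 / 2 : ℚ) • Matrix.det (Matrix.of fun i j : Fin (lam.colLen 0) =>
    h ((lam.rowLen i : ℤ) - ((i : ℤ) + 1) + ((j : ℤ) + 1)) +
      h ((lam.rowLen i : ℤ) - ((i : ℤ) + 1) - ((j : ℤ) + 1) + 2))

/-- The universal orthogonal Schur function of a partition `lam = (lam_1, …, lam_k)` of length `k`,
namely `det (h_{lam_i - i + j} - h_{lam_i - i - j})_{1 ≤ i, j ≤ k}`. -/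
def o (lam : YoungDiagram) : symmetricFunctions :=
  Matrix.det (Matrix.of fun i j : Fin (lam.colLen 0) =>
    h ((lam.rowLen i : ℤ) - ((i : ℤ) + 1) + ((j : ℤ) + 1)) -
      h ((lam.rowLen i : ℤ) - ((i : ℤ) + 1) - ((j : ℤ) + 1)))

end SymFun

end

/-! ### Power sums as free generators. -/

noncomputable section
namespace SymFun
open MvPowerSeries

/-! A product of `l` power sums has no monomial in more than `l` variables, and its monomials in
exactly `l` variables are those whose exponents are the indices of the factors. This triangularity
(`coeff_prod_pseries`) makes the `p_n` generate the ring (`adjoin_p_eq_top`) and be algebraically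
independent (`algebraicIndependent_p`). So the ring is polynomial in the `p_n`, and existence,
uniqueness and involutivity of `ω` can be checked on generators.

Newton's identities say `H' = P H` for the generating series of the `h_n`. Applying `ω` shows that
`F(t) = ∑ ω(h_n) (-t)^n` satisfies `F' = -P F`, whence `H F = 1`: the `ω(h_n)` play the role of the
elementary functions `e_n`.

The determinantal identity is a duality of minors. Inside a `k × n` box, the row and column
coordinates of a partition together fill an interval of integers. Indexing by them gives a square
matrix of `h`'s whose inverse is a signed matrix of `e`'s. One unipotent column operation folds
reflected columns into the first `k` and creates the symplectic matrix as a corner block; the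
inverse operation on the inverse matrix creates the orthogonal matrix of the conjugate partition as
the opposite block. Jacobi's identity compares the two determinants, and the signs cancel because
the big matrix has determinant `(-1)^|lam|`. -/

theorem coeff_pseries_mul (n : ℕ) (hn : 1 ≤ n) (g : MvPowerSeries ℕ ℚ) (m : ℕ →₀ ℕ) :
    coeff m (pseries n * g) =
      ∑ i ∈ m.support with n ≤ m i, coeff (m - Finsupp.single i n) g := by
  classical
  rw [coeff_mul]
  symm
  refine Finset.sum_of_injOn (fun i => (Finsupp.single i n, m - Finsupp.single i n)) ?_ ?_ ?_ ?_
  · intro i _ j _ hij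
    exact Finsupp.single_left_injective (by omega : n ≠ 0) (Prod.ext_iff.1 hij).1
  · intro i hi
    have h2 : n ≤ m i := (Finset.mem_filter.1 hi).2
    exact Finset.HasAntidiagonal.mem_antidiagonal.2 (add_tsub_cancel_of_le (Finsupp.single_le_iff.2 h2))
  · rintro ⟨a, b⟩ hab hni
    have hab := Finset.HasAntidiagonal.mem_antidiagonal.1 hab
    simp only at hab ⊢
    rw [coeff_pseries, if_neg, zero_mul]
    rintro ⟨i, rfl⟩
    refine hni ⟨i, ?_, ?_⟩
    · have : n ≤ m i := by rw [← hab]; simp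
      simp only [Finset.coe_filter, Finsupp.mem_support_iff, Set.mem_ofPred_eq]
      omega
    · simp only [← hab, add_tsub_cancel_left]
  · intro i _
    rw [coeff_pseries, if_pos ⟨i, rfl⟩, one_mul]

/-- The multiset of nonzero exponents of a monomial. -/
def expType (m : ℕ →₀ ℕ) : Multiset ℕ := m.support.val.map m

theorem card_expType (m : ℕ →₀ ℕ) : (expType m).card = m.support.card := by
  simp [expType]

theorem zero_notMem_expType (m : ℕ →₀ ℕ) : 0 ∉ expType m := by
  simp [expType]

theorem support_sub_single {m : ℕ →₀ ℕ} {i n : ℕ} (h : n < m i) :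
    (m - Finsupp.single i n).support = m.support := by
  ext j
  rcases eq_or_ne j i with rfl | hj
  · simp; omega
  · simp [hj.symm]

theorem expType_sub_single {m : ℕ →₀ ℕ} {i : ℕ} (hi : m i ≠ 0) :
    m i ::ₘ expType (m - Finsupp.single i (m i)) = expType m := by
  classical
  have hs : (m - Finsupp.single i (m i)).support = m.support.erase i := by
    ext j
    rcases eq_or_ne j i with rfl | hj
    · simp
    · simp [hj]
  have hi' : i ∈ m.support := Finsupp.mem_support_iff.2 hi
  rw [expType, expType, hs, ← Finset.insert_erase hi', Finset.erase_insert_eq_erase,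
    Finset.insert_val_of_notMem (Finset.notMem_erase _ _), Multiset.map_cons]
  congr 1
  refine Multiset.map_congr (by simp) fun j hj => ?_
  have : j ≠ i := Finset.ne_of_mem_erase hj
  simp [this.symm]

/-- Triangularity of the products of power sums with respect to the monomials. -/
theorem coeff_prod_pseries (s : Multiset ℕ) (hs : 0 ∉ s) (m : ℕ →₀ ℕ)
    (hm : s.card ≤ m.support.card) :
    (expType m = s → 0 < coeff m (s.map pseries).prod) ∧
      (expType m ≠ s → coeff m (s.map pseries).prod = 0) := by
  induction s using Multiset.induction generalizing m with
  | empty =>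
    classical
    have : expType m = 0 ↔ m = 0 := by
      rw [← Multiset.card_eq_zero, card_expType]; simp
    rw [Multiset.map_zero, Multiset.prod_zero, coeff_one]
    exact ⟨fun h => by simp [this.1 h], fun h => if_neg (mt this.2 h)⟩
  | cons n s ih =>
    have hn : 1 ≤ n := Nat.one_le_iff_ne_zero.2 fun h => hs (by simp [h])
    have hs' : 0 ∉ s := fun h => hs (Multiset.mem_cons_of_mem h)
    rw [Multiset.card_cons] at hm
    rw [Multiset.map_cons, Multiset.prod_cons, coeff_pseries_mul n hn]
    -- Lowering an exponent larger than `n` loses no variable, so more variables remain than there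
    -- are factors in `s`.
    have hlt : ∀ i, n < m i → coeff (m - Finsupp.single i n) (s.map pseries).prod = 0 := by
      intro i hi
      refine (ih hs' _ (by rw [support_sub_single hi]; omega)).2 fun h => ?_
      have := congrArg Multiset.card h
      rw [card_expType, support_sub_single hi] at this
      omega
    have hcard : ∀ i, m i = n → s.card ≤ (m - Finsupp.single i n).support.card := by
      intro i hi
      have := congrArg Multiset.card (expType_sub_single (m := m) (i := i) (by omega))
      rw [Multiset.card_cons, card_expType, card_expType, hi] at this
      omega
    have heq : ∀ i, m i = n → (expType (m - Finsupp.single i n) = s ↔ expType m = n ::ₘ s) := by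
      intro i hi
      rw [← expType_sub_single (m := m) (i := i) (by omega), hi, Multiset.cons_inj_right]
    constructor
    · intro h
      refine Finset.sum_pos' (fun i hi => ?_) ?_
      · rcases (Finset.mem_filter.1 hi).2.lt_or_eq with hi | hi
        · exact (hlt i hi).ge
        · exact ((ih hs' _ (hcard i hi.symm)).1 ((heq i hi.symm).2 h)).le
      · have : n ∈ expType m := h ▸ Multiset.mem_cons_self n s
        obtain ⟨i, hi, hin⟩ := Multiset.mem_map.1 this
        exact ⟨i, Finset.mem_filter.2 ⟨hi, hin.ge⟩, (ih hs' _ (hcard i hin)).1 ((heq i hin).2 h)⟩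
    · intro h
      refine Finset.sum_eq_zero fun i hi => ?_
      rcases (Finset.mem_filter.1 hi).2.lt_or_eq with hi | hi
      · exact hlt i hi
      · exact (ih hs' _ (hcard i hi.symm)).2 (mt (heq i hi.symm).1 h)

theorem exists_expType_eq (s : Multiset ℕ) (hs : 0 ∉ s) : ∃ m, expType m = s := by
  classical
  induction s using Multiset.induction with
  | empty => exact ⟨0, by simp [expType]⟩
  | cons n s ih =>
    obtain ⟨m, rfl⟩ := ih fun h => hs (Multiset.mem_cons_of_mem h)
    obtain ⟨i, hi⟩ := Infinite.exists_notMem_finset m.support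
    have hn : n ≠ 0 := fun h => hs (by simp [h])
    have hmi := Finsupp.notMem_support_iff.1 hi
    refine ⟨m + Finsupp.single i n, ?_⟩
    rw [← expType_sub_single (i := i) (by simp [hn])]
    simp [hmi]

/-- Monomials with the same exponents up to order differ by a permutation of the variables. -/
theorem exists_perm_of_expType_eq {m m' : ℕ →₀ ℕ} (h : expType m = expType m') :
    ∃ σ : Equiv.Perm ℕ, ∀ i, m' (σ i) = m i := by
  classical
  have key : ∀ v : ℕ, Nonempty ({i // m i = v} ≃ {i // m' i = v}) := by
    intro v
    rcases eq_or_ne v 0 with rfl | hv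
    -- The unused variables form a countably infinite set for either monomial; every other fibre is
    -- finite, with size a multiplicity in `expType`.
    · have inf : ∀ m : ℕ →₀ ℕ, Infinite {i // m i = 0} := fun m => by
        have : {i | m i = 0} = (m.support : Set ℕ)ᶜ := by ext; simp
        exact (this ▸ m.support.finite_toSet.infinite_compl).to_subtype
      have := inf m
      have := inf m'
      obtain ⟨d⟩ := nonempty_denumerable {i // m i = 0}
      obtain ⟨d'⟩ := nonempty_denumerable {i // m' i = 0}
      exact ⟨Denumerable.equiv₂ _ _⟩
    · have cnt : ∀ m : ℕ →₀ ℕ, Nat.card {i // m i = v} = (expType m).count v := fun m => by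
        have : ∀ i, m i = v ↔ i ∈ m.support.filter (fun i => v = m i) := fun i => by
          simp only [Finset.mem_filter, Finsupp.mem_support_iff]; omega
        rw [Nat.card_congr (Equiv.subtypeEquivRight this), Nat.card_eq_fintype_card,
          Fintype.card_coe, expType, Multiset.count_map]
        rfl
      have fin : ∀ m : ℕ →₀ ℕ, Finite {i // m i = v} := fun m =>
        (m.support.finite_toSet.subset fun i (hi : m i = v) => by simp [hi, hv]).to_subtype
      have := fin m
      have := fin m'
      exact ⟨(Finite.equivFinOfCardEq (by rw [cnt, h])).trans (Finite.equivFinOfCardEq (cnt m')).symm⟩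
  have e := fun v => (key v).some
  refine ⟨(Equiv.sigmaFiberEquiv m).symm.trans
    ((Equiv.sigmaCongrRight fun v => (e v)).trans (Equiv.sigmaFiberEquiv m')), fun i => ?_⟩
  exact (e (m i) ⟨i, rfl⟩).2

theorem coeff_eq_of_expType_eq (f : symmetricFunctions) {m m' : ℕ →₀ ℕ}
    (h : expType m = expType m') : coeff m (f : MvPowerSeries ℕ ℚ) = coeff m' f.1 := by
  obtain ⟨σ, hσ⟩ := exists_perm_of_expType_eq h
  rw [← (isSymmetric_iff f.1).1 f.2.1 σ m]
  congr 2
  ext i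
  obtain ⟨j, rfl⟩ := σ.surjective i
  rw [hσ]
  exact Finsupp.embDomain_apply_self σ.toEmbedding m j

theorem coe_prod_p (s : Multiset ℕ) :
    ((s.map p).prod : MvPowerSeries ℕ ℚ) = (s.map pseries).prod := by
  induction s using Multiset.induction with
  | empty => simp
  | cons n s ih => simp only [Multiset.map_cons, Multiset.prod_cons, MulMemClass.coe_mul, ih]; rfl

theorem finite_expType_bounded (d l : ℕ) :
    {s : Multiset ℕ | s.card = l ∧ ∀ x ∈ s, x ≤ d}.Finite := by
  have : {s : Multiset ℕ | s.card = l ∧ ∀ x ∈ s, x ≤ d} ⊆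
      Set.range fun f : Fin l → Fin (d + 1) => Finset.univ.val.map fun i => (f i : ℕ) := by
    rintro s ⟨hs, hd⟩
    induction s using Quotient.inductionOn with
    | h L =>
      obtain rfl : L.length = l := hs
      refine ⟨fun i => ⟨L.get i, Nat.lt_succ_of_le (hd _ (List.get_mem _ _))⟩, ?_⟩
      simp
  exact (Set.finite_range _).subset this

/-- The power sums generate the ring of symmetric functions. -/
theorem adjoin_p_eq_top : Algebra.adjoin ℚ (Set.range fun k => p (k + 1)) = ⊤ := by
  classical
  set A := Algebra.adjoin ℚ (Set.range fun k => p (k + 1))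
  have hprod : ∀ s : Multiset ℕ, 0 ∉ s → (s.map p).prod ∈ A := fun s hs => by
    refine multiset_prod_mem _ fun x hx => ?_
    obtain ⟨n, hn, rfl⟩ := Multiset.mem_map.1 hx
    have hn0 : n ≠ 0 := fun h => hs (h ▸ hn)
    obtain ⟨k, rfl⟩ := Nat.exists_eq_succ_of_ne_zero hn0
    exact Algebra.subset_adjoin ⟨k, rfl⟩
  -- Induction on a strict bound for the number of variables in a monomial of `f`: subtracting
  -- products of `l` power sums kills the top layer.
  have key : ∀ (l : ℕ) (f : symmetricFunctions),
      (∀ m : ℕ →₀ ℕ, l ≤ m.support.card → coeff m f.1 = 0) → f ∈ A := by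
    intro l
    induction l with
    | zero =>
      intro f hf
      have : f = 0 := Subtype.ext (MvPowerSeries.ext fun m => by simpa using hf m (Nat.zero_le _))
      exact this ▸ A.zero_mem
    | succ l ih =>
      intro f hf
      obtain ⟨d, hd⟩ := f.2.2
      have hfin : {s : Multiset ℕ | (s.card = l ∧ ∀ x ∈ s, x ≤ d) ∧ 0 ∉ s}.Finite :=
        (finite_expType_bounded d l).subset fun s hs => hs.1
      choose! mon hmon using exists_expType_eq
      -- Dividing by the nonzero diagonal coefficient makes `g` agree with `f` on monomials of type
      -- `s`.
      let c : Multiset ℕ → ℚ := fun s => coeff (mon s) f.1 / coeff (mon s) (s.map pseries).prod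
      let g : symmetricFunctions := ∑ s ∈ hfin.toFinset, c s • (s.map p).prod
      have hg : g ∈ A := A.sum_mem fun s hs =>
        A.smul_mem (hprod s (hfin.mem_toFinset.1 hs).2) _
      have hcg : ∀ m, coeff m g.1 = ∑ s ∈ hfin.toFinset, c s * coeff m (s.map pseries).prod := by
        intro m
        simp only [g, AddSubmonoidClass.coe_finsetSum, map_sum, SetLike.val_smul, coe_prod_p]
        rfl
      suffices f - g ∈ A by simpa using A.add_mem this hg
      refine ih _ fun m hm => ?_
      have hsub : coeff m (f - g).1 = coeff m f.1 - coeff m g.1 := by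
        rw [AddSubgroupClass.coe_sub, map_sub]
      rw [hsub, hcg, sub_eq_zero]
      have htri : ∀ s ∈ hfin.toFinset, expType m ≠ s → coeff m (s.map pseries).prod = 0 := by
        intro s hs
        have hs := hfin.mem_toFinset.1 hs
        exact (coeff_prod_pseries s hs.2 m (by rw [hs.1.1]; exact hm)).2
      by_cases hmem : expType m ∈ hfin.toFinset
      · rw [Finset.sum_eq_single_of_mem _ hmem fun s hs hne => by
          rw [htri s hs hne.symm, mul_zero]]
        have h0 := zero_notMem_expType m
        have hcm := (coeff_prod_pseries (expType m) h0 m (card_expType m).le).1 rfl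
        have e1 := coeff_eq_of_expType_eq f (hmon _ h0)
        have e2 := coeff_eq_of_expType_eq ((expType m).map p).prod (hmon _ h0)
        rw [coe_prod_p] at e2
        simp only [c]
        rw [e1, e2, div_mul_cancel₀ _ hcm.ne']
      · rw [Finset.sum_eq_zero fun s hs => by
          rw [htri s hs (fun h => hmem (h ▸ hs)), mul_zero]]
        -- A type outside the finite index set has more than `l` parts or a part above the degree
        -- bound `d`; either way `f` has coefficient zero there.
        rcases hm.lt_or_eq with hlt | heq
        · exact hf m hlt
        · have : ∃ x ∈ expType m, d < x := by
            by_contra! hc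
            exact hmem (hfin.mem_toFinset.2
              ⟨⟨by rw [card_expType]; exact heq.symm, hc⟩, zero_notMem_expType m⟩)
          obtain ⟨x, hx, hdx⟩ := this
          obtain ⟨i, hi, rfl⟩ := Multiset.mem_map.1 hx
          exact hd m (lt_of_lt_of_le hdx (Finsupp.le_degree i m))
  refine eq_top_iff.2 fun f _ => ?_
  obtain ⟨d, hd⟩ := f.2.2
  refine key (d + 1) f fun m hm => hd m (lt_of_lt_of_le hm ?_)
  rw [Finsupp.degree_apply, Finset.card_eq_sum_ones]
  exact Finset.sum_le_sum fun i hi => Nat.one_le_iff_ne_zero.2 (Finsupp.mem_support_iff.1 hi)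

/-- The multiset of indices of the power sums in a monomial in `p_1, p_2, …`. -/
def indexMultiset (a : ℕ →₀ ℕ) : Multiset ℕ := (Finsupp.toMultiset a).map (· + 1)

theorem aeval_p_monomial (a : ℕ →₀ ℕ) (c : ℚ) :
    MvPolynomial.aeval (fun k => p (k + 1)) (MvPolynomial.monomial a c) =
      c • ((indexMultiset a).map p).prod := by
  rw [MvPolynomial.aeval_monomial, Algebra.smul_def]
  congr 1
  rw [indexMultiset, Multiset.map_map, Finsupp.toMultiset_map, Finsupp.prod_toMultiset,
    Finsupp.prod_mapDomain_index (fun _ => pow_zero _) (fun _ _ _ => pow_add _ _ _)]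
  rfl

theorem algebraicIndependent_p : AlgebraicIndependent ℚ fun k => p (k + 1) := by
  classical
  rw [algebraicIndependent_iff]
  intro P hP
  by_contra hne
  -- With the number of factors maximal, triangularity makes every other term of `P` vanish at a
  -- monomial of type `indexMultiset a`.
  obtain ⟨a, ha, hmax⟩ := Finset.exists_max_image P.support (fun a => (indexMultiset a).card)
    (MvPolynomial.support_nonempty.2 hne)
  have h0 : ∀ a, 0 ∉ indexMultiset a := fun a => by simp [indexMultiset]
  have hinj : Function.Injective indexMultiset :=
    (Multiset.map_injective (add_left_injective 1)).comp Multiset.toFinsupp.symm.injective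
  obtain ⟨m, hm⟩ := exists_expType_eq _ (h0 a)
  rw [P.as_sum, map_sum] at hP
  have h1 := congrArg (fun f : symmetricFunctions => coeff m f.1) hP
  simp only [aeval_p_monomial, AddSubmonoidClass.coe_finsetSum, map_sum, SetLike.val_smul,
    coe_prod_p] at h1
  rw [Finset.sum_eq_single_of_mem a ha] at h1
  · have := (coeff_prod_pseries _ (h0 a) m (by rw [← hm, card_expType])).1 hm
    rw [MvPowerSeries.coeff_smul] at h1
    rcases mul_eq_zero.1 h1 with h1 | h1
    · exact MvPolynomial.mem_support_iff.1 ha h1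
    · exact this.ne' h1
  · intro b hb hba
    have := (coeff_prod_pseries _ (h0 b) m (by
      rw [← card_expType, hm]; exact hmax b hb)).2 (by rw [hm]; exact fun h => hba (hinj h).symm)
    rw [MvPowerSeries.coeff_smul, this, mul_zero]

end SymFun

/-! ### Complementary minors and Maya coordinates. -/

namespace SymFun

open Matrix in
/-- Jacobi's complementary minor identity, in block form. -/
theorem det_toBlocks₁₁_eq {m n R : Type*} [CommRing R] [Fintype m] [Fintype n] [DecidableEq m]
    [DecidableEq n] (M N : Matrix (m ⊕ n) (m ⊕ n) R) (hMN : M * N = 1) :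
    M.toBlocks₁₁.det = M.det * N.toBlocks₂₂.det := by
  have h1 : fromBlocks M.toBlocks₁₁ M.toBlocks₁₂ M.toBlocks₂₁ M.toBlocks₂₂ *
      fromBlocks N.toBlocks₁₁ N.toBlocks₁₂ N.toBlocks₂₁ N.toBlocks₂₂ = fromBlocks 1 0 0 1 := by
    rw [fromBlocks_toBlocks, fromBlocks_toBlocks, hMN, fromBlocks_one]
  rw [fromBlocks_multiply, fromBlocks_inj] at h1
  -- Keeping the second block column of `N` gives the second block column of the identity; taking
  -- determinants finishes.
  have h2 : M * fromBlocks 1 N.toBlocks₁₂ 0 N.toBlocks₂₂ =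
      fromBlocks M.toBlocks₁₁ 0 M.toBlocks₂₁ 1 := by
    conv_lhs => rw [← fromBlocks_toBlocks M]
    rw [fromBlocks_multiply, h1.2.1, h1.2.2.2]
    simp
  have h3 := congrArg det h2
  rw [det_mul, det_fromBlocks_zero₂₁, det_fromBlocks_zero₁₂] at h3
  simpa using h3.symm

/-- The Maya diagram coordinates of a partition in a `k × n` box: the row lengths give
`lam_i - i`, the column lengths give the complementary values. -/
def maya (lam : YoungDiagram) (k n : ℕ) : Fin k ⊕ Fin n → ℤ :=
  Sum.elim (fun i => (lam.rowLen i : ℤ) - i - 1) (fun j => (j : ℤ) - lam.colLen j)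

/-- Column coordinates complementary to those of the empty partition. -/
def mayaCol (k n : ℕ) : Fin k ⊕ Fin n → ℤ :=
  Sum.elim (fun i => (i : ℤ) + 1) (fun j => -(j : ℤ))

theorem maya_bot (k n : ℕ) (x : Fin k ⊕ Fin n) : maya ⊥ k n x = -mayaCol k n x := by
  have h1 : ∀ i, (⊥ : YoungDiagram).rowLen i = 0 := fun i => by
    rw [YoungDiagram.rowLen_eq_card]; simp [YoungDiagram.row]
  have h2 : ∀ i, (⊥ : YoungDiagram).colLen i = 0 := fun i => by
    rw [YoungDiagram.colLen_eq_card]; simp [YoungDiagram.col]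
  rcases x with i | j <;> simp [maya, mayaCol, h1, h2]
  ring

/-- A nonempty Young diagram has a removable cell. -/
theorem exists_corner (lam : YoungDiagram) (hlam : lam ≠ ⊥) :
    ∃ (mu : YoungDiagram) (i j : ℕ), mu.cells.card + 1 = lam.cells.card ∧
      lam.rowLen i = j + 1 ∧ mu.rowLen i = j ∧ lam.colLen j = i + 1 ∧ mu.colLen j = i ∧
      (∀ i', i' ≠ i → mu.rowLen i' = lam.rowLen i') ∧
      (∀ j', j' ≠ j → mu.colLen j' = lam.colLen j') := by
  have hne : ∃ c, c ∈ lam := by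
    by_contra! hc
    exact hlam (YoungDiagram.ext (Finset.eq_empty_of_forall_notMem hc))
  obtain ⟨⟨a, j⟩, hc⟩ := hne
  have ha := YoungDiagram.mem_iff_lt_colLen.1 hc
  have h0 : 0 < lam.colLen 0 := by
    have := lam.colLen_anti 0 j (Nat.zero_le _)
    omega
  -- The corner chosen is the end of the last row.
  obtain ⟨i, hi⟩ : ∃ i, lam.colLen 0 = i + 1 := ⟨lam.colLen 0 - 1, by omega⟩
  have hi0 : (i, 0) ∈ lam := YoungDiagram.mem_iff_lt_colLen.2 (by omega)
  have := YoungDiagram.mem_iff_lt_rowLen.1 hi0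
  obtain ⟨j, hj⟩ : ∃ j, lam.rowLen i = j + 1 := ⟨lam.rowLen i - 1, by omega⟩
  have hij : (i, j) ∈ lam := YoungDiagram.mem_iff_lt_rowLen.2 (by omega)
  have hmax : ∀ c ∈ lam, (i, j) ≤ c → c = (i, j) := by
    rintro ⟨x, y⟩ hxy ⟨h1, h2⟩
    have e1 : x < lam.colLen 0 :=
      YoungDiagram.mem_iff_lt_colLen.1 (lam.up_left_mem le_rfl (Nat.zero_le _) hxy)
    have h1' : i ≤ x := h1
    have h2' : j ≤ y := h2
    obtain rfl : x = i := by omega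
    have e2 := YoungDiagram.mem_iff_lt_rowLen.1 hxy
    exact Prod.ext rfl (by simp; omega)
  let mu : YoungDiagram := ⟨lam.cells.erase (i, j), by
    intro c d hdc hc
    simp only [Finset.coe_erase, Set.mem_sdiff, Finset.mem_coe, Set.mem_singleton_iff] at hc ⊢
    refine ⟨lam.isLowerSet hdc hc.1, ?_⟩
    rintro rfl
    exact hc.2 (hmax c hc.1 hdc)⟩
  have hmem : ∀ c, c ∈ mu ↔ c ∈ lam ∧ c ≠ (i, j) := fun c => by
    change c ∈ lam.cells.erase (i, j) ↔ _
    rw [Finset.mem_erase, YoungDiagram.mem_cells, and_comm]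
  have hrow : ∀ x y, y < mu.rowLen x ↔ y < lam.rowLen x ∧ (x, y) ≠ (i, j) := fun x y => by
    rw [← YoungDiagram.mem_iff_lt_rowLen, hmem, YoungDiagram.mem_iff_lt_rowLen]
  have hcol : ∀ x y, x < mu.colLen y ↔ x < lam.colLen y ∧ (x, y) ≠ (i, j) := fun x y => by
    rw [← YoungDiagram.mem_iff_lt_colLen, hmem, YoungDiagram.mem_iff_lt_colLen]
  have hcj : lam.colLen j = i + 1 := by
    have e1 := lam.colLen_anti 0 j (Nat.zero_le _)
    have e2 := YoungDiagram.mem_iff_lt_colLen.1 hij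
    omega
  refine ⟨mu, i, j, ?_, hj, ?_, hcj, ?_, ?_, ?_⟩
  · exact Finset.card_erase_add_one hij
  · refine eq_of_forall_lt_iff fun y => ?_
    rw [hrow, hj]; simp; omega
  · refine eq_of_forall_lt_iff fun x => ?_
    rw [hcol, hcj]; simp; omega
  · intro x hx
    refine eq_of_forall_lt_iff fun y => ?_
    rw [hrow]; simp [hx]
  · intro y hy
    refine eq_of_forall_lt_iff fun x => ?_
    rw [hcol]; simp [hy]

/-! ### The matrix of `h`'s, its determinant and its inverse. -/

section
variable {R : Type*} [CommRing R]

/-- The upper right block has only negative indices, and both diagonal blocks are triangular with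
diagonal `h 0 = 1`. -/
theorem det_maya_bot (h : ℤ → R) (h0 : h 0 = 1) (hneg : ∀ z < 0, h z = 0) (k n : ℕ) :
    (Matrix.of fun x y => h (maya ⊥ k n x + mayaCol k n y)).det = 1 := by
  have : (Matrix.of fun x y => h (maya ⊥ k n x + mayaCol k n y)) =
      Matrix.fromBlocks (Matrix.of fun i j : Fin k => h ((j : ℤ) - i)) 0
        (Matrix.of fun (i : Fin n) (j : Fin k) => h ((i : ℤ) + j + 1))
        (Matrix.of fun i j : Fin n => h ((i : ℤ) - j)) := by
    ext (i | i) (j | j)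
    · simp only [Matrix.of_apply, maya_bot, mayaCol, Sum.elim_inl, Matrix.fromBlocks_apply₁₁]
      congr 1; ring
    · simp only [Matrix.of_apply, maya_bot, mayaCol, Sum.elim_inl, Sum.elim_inr,
        Matrix.fromBlocks_apply₁₂, Matrix.zero_apply]
      exact hneg _ (by omega)
    · simp only [Matrix.of_apply, maya_bot, mayaCol, Sum.elim_inl, Sum.elim_inr,
        Matrix.fromBlocks_apply₂₁]
      congr 1; ring
    · simp only [Matrix.of_apply, maya_bot, mayaCol, Sum.elim_inr, Matrix.fromBlocks_apply₂₂]
      congr 1; ring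
  rw [this, Matrix.det_fromBlocks_zero₁₂, Matrix.det_of_isUpperTriangular,
    Matrix.det_of_isLowerTriangular]
  · simp [h0]
  · intro i j hij
    have : i < j := hij
    exact hneg _ (by simpa using this)
  · intro i j hij
    have : j < i := hij
    exact hneg _ (by simpa using this)

/-- Removing a corner `(i, j)` exchanges the coordinates `j - i` of row `i` and `j - i - 1` of
column `j`. Each cell is thus one row transposition away from the empty partition. -/
theorem det_maya (h : ℤ → R) (h0 : h 0 = 1) (hneg : ∀ z < 0, h z = 0) (k n : ℕ)
    (lam : YoungDiagram) (hk : lam.colLen 0 ≤ k) (hn : lam.rowLen 0 ≤ n) :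
    (Matrix.of fun x y => h (maya lam k n x + mayaCol k n y)).det =
      (-1) ^ lam.cells.card := by
  induction hc : lam.cells.card generalizing lam with
  | zero =>
    obtain rfl : lam = ⊥ := YoungDiagram.ext (Finset.card_eq_zero.1 hc)
    rw [det_maya_bot h h0 hneg, pow_zero]
  | succ c ih =>
    have hlam : lam ≠ ⊥ := by rintro rfl; simp at hc
    obtain ⟨mu, i, j, hcard, h1, h2, h3, h4, h5, h6⟩ := exists_corner lam hlam
    have hik : i < k := by
      have := lam.colLen_anti 0 j (Nat.zero_le _)
      omega
    have hjn : j < n := by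
      have := lam.rowLen_anti 0 i (Nat.zero_le _)
      omega
    have hmk : mu.colLen 0 ≤ k := by
      rcases eq_or_ne 0 j with rfl | hj
      · omega
      · rw [h6 0 hj]; exact hk
    have hmn : mu.rowLen 0 ≤ n := by
      rcases eq_or_ne 0 i with rfl | hi
      · omega
      · rw [h5 0 hi]; exact hn
    have hmu := ih mu hmk hmn (by omega)
    let s : Equiv.Perm (Fin k ⊕ Fin n) := Equiv.swap (Sum.inl ⟨i, hik⟩) (Sum.inr ⟨j, hjn⟩)
    have hs : ∀ x, maya lam k n x = maya mu k n (s x) := by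
      intro x
      rcases eq_or_ne x (Sum.inl ⟨i, hik⟩) with rfl | hx
      · simp [s, maya, h1, h4]
        ring
      rcases eq_or_ne x (Sum.inr ⟨j, hjn⟩) with rfl | hy
      · simp [s, maya, h3, h2]
        ring
      rw [show s x = x from Equiv.swap_apply_of_ne_of_ne hx hy]
      rcases x with x | x
      · simp [maya, h5 x (fun h => hx (by simp [Fin.ext_iff, h]))]
      · simp [maya, h6 x (fun h => hy (by simp [Fin.ext_iff, h]))]
    have hM : (Matrix.of fun x y => h (maya lam k n x + mayaCol k n y)) =
        (Matrix.of fun x y => h (maya mu k n x + mayaCol k n y)).submatrix s id := by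
      ext x y
      simp [hs]
    rw [hM, Matrix.det_permute, hmu, Equiv.Perm.sign_swap (by simp)]
    simp [pow_succ]

/-- The sign `(-1) ^ z` for an integer `z`. -/
def zsign (R : Type*) [CommRing R] (z : ℤ) : R := (((-1 : Rˣ) ^ z : Rˣ) : R)

theorem zsign_add (a b : ℤ) : zsign R (a + b) = zsign R a * zsign R b := by
  simp [zsign, zpow_add]

theorem zsign_natCast (a : ℕ) : zsign R a = (-1) ^ a := by
  simp [zsign]

theorem zsign_two_mul (a : ℤ) : zsign R (2 * a) = 1 := by
  simp [zsign, zpow_mul]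

theorem zsign_mul_self (a : ℤ) : zsign R a * zsign R a = 1 := by
  rw [← zsign_add, ← two_mul, zsign_two_mul]

theorem mayaCol_injective (k n : ℕ) : Function.Injective (mayaCol k n) := by
  rintro (i | i) (j | j) hij <;> simp only [mayaCol, Sum.elim_inl, Sum.elim_inr] at hij
  · exact congrArg Sum.inl (Fin.ext (by omega))
  · omega
  · omega
  · exact congrArg Sum.inr (Fin.ext (by omega))

theorem exists_mayaCol_eq (k n : ℕ) (c : ℤ) (h1 : -n < c) (h2 : c ≤ k) :
    ∃ y, mayaCol k n y = c := by
  rcases le_or_gt c 0 with hc | hc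
  · exact ⟨Sum.inr ⟨(-c).toNat, by omega⟩, by simp [mayaCol]; omega⟩
  · exact ⟨Sum.inl ⟨(c - 1).toNat, by omega⟩, by simp [mayaCol]; omega⟩

/-- The value `j - i` separates the two: the row coordinate is at least `j - i` and the column
coordinate below it if `(i, j)` is a cell, and the reverse holds otherwise. -/
theorem maya_inl_ne_inr (lam : YoungDiagram) (k n : ℕ) (i : Fin k) (j : Fin n) :
    maya lam k n (Sum.inl i) ≠ maya lam k n (Sum.inr j) := by
  have h1 := YoungDiagram.mem_iff_lt_rowLen (μ := lam) (i := i) (j := j)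
  have h2 := YoungDiagram.mem_iff_lt_colLen (μ := lam) (i := i) (j := j)
  simp only [maya, Sum.elim_inl, Sum.elim_inr]
  by_cases h : ((i : ℕ), (j : ℕ)) ∈ lam
  · have := h1.1 h
    have := h2.1 h
    omega
  · have := mt h1.2 h
    have := mt h2.2 h
    omega

theorem maya_injective (lam : YoungDiagram) (k n : ℕ) : Function.Injective (maya lam k n) := by
  rintro (i | i) (j | j) hij
  · simp only [maya, Sum.elim_inl] at hij
    refine congrArg Sum.inl (Fin.ext ?_)
    rcases le_total (i : ℕ) j with h | h
    · have := lam.rowLen_anti _ _ h; omega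
    · have := lam.rowLen_anti _ _ h; omega
  · exact (maya_inl_ne_inr _ _ _ _ _ hij).elim
  · exact (maya_inl_ne_inr _ _ _ _ _ hij.symm).elim
  · simp only [maya, Sum.elim_inr] at hij
    refine congrArg Sum.inr (Fin.ext ?_)
    rcases le_total (i : ℕ) j with h | h
    · have := lam.colLen_anti _ _ h; omega
    · have := lam.colLen_anti _ _ h; omega

theorem maya_lt (lam : YoungDiagram) {k n : ℕ} (hn : lam.rowLen 0 ≤ n) (x : Fin k ⊕ Fin n) :
    maya lam k n x < n := by
  rcases x with i | j <;> simp only [maya, Sum.elim_inl, Sum.elim_inr]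
  · have := lam.rowLen_anti 0 i (Nat.zero_le _); omega
  · omega

theorem neg_le_maya (lam : YoungDiagram) {k n : ℕ} (hk : lam.colLen 0 ≤ k) (x : Fin k ⊕ Fin n) :
    -k ≤ maya lam k n x := by
  rcases x with i | j <;> simp only [maya, Sum.elim_inl, Sum.elim_inr]
  · omega
  · have := lam.colLen_anti 0 j (Nat.zero_le _); omega

theorem card_cells_eq_sum_colLen (lam : YoungDiagram) {n : ℕ} (hn : lam.rowLen 0 ≤ n) :
    lam.cells.card = ∑ j : Fin n, lam.colLen j := by
  rw [Fin.sum_univ_eq_sum_range (fun j => lam.colLen j) n,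
    Finset.card_eq_sum_card_fiberwise (f := Prod.snd) (t := Finset.range n)]
  · exact Finset.sum_congr rfl fun j _ => lam.colLen_eq_card.symm
  · rintro ⟨i, j⟩ hij
    have h1 := YoungDiagram.mem_iff_lt_rowLen.1 (show (i, j) ∈ lam from hij)
    have h2 := lam.rowLen_anti 0 i (Nat.zero_le _)
    simp
    omega

/-- The matrices `(h_{a + c})` and `((-1)^{c + a} e_{-c - a})` are inverse to each other. -/
theorem toeplitz_mul_eq_one (h e : ℤ → R) (hneg : ∀ z < 0, h z = 0) (eneg : ∀ z < 0, e z = 0)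
    (rel : ∀ m : ℕ, ∑ q ∈ Finset.HasAntidiagonal.antidiagonal m, h q.1 * ((-1) ^ q.2 * e q.2) =
      if m = 0 then 1 else 0) (lam : YoungDiagram) (k n : ℕ)
    (hk : lam.colLen 0 ≤ k) (hn : lam.rowLen 0 ≤ n) :
    (Matrix.of fun x y => h (maya lam k n x + mayaCol k n y)) *
      (Matrix.of fun y x => zsign R (-mayaCol k n y - maya lam k n x) *
        e (-mayaCol k n y - maya lam k n x)) = 1 := by
  ext x x'
  rw [Matrix.mul_apply]
  simp only [Matrix.of_apply]
  have ha := maya_lt lam hn x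
  have hb := neg_le_maya lam hk x'
  rw [Matrix.one_apply]
  simp only [← (maya_injective lam k n).eq_iff (a := x)]
  generalize maya lam k n x = a at *
  generalize maya lam k n x' = b at *
  rcases lt_or_ge a b with hab | hab
  · rw [if_neg (by omega)]
    refine Finset.sum_eq_zero fun y _ => ?_
    rcases lt_or_ge (a + mayaCol k n y) 0 with hc | hc
    · rw [hneg _ hc, zero_mul]
    · rw [eneg _ (by omega), mul_zero, mul_zero]
  · obtain ⟨m, hm⟩ : ∃ m : ℕ, a = b + m := ⟨(a - b).toNat, by omega⟩
    have := rel m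
    have hif : (if a = b then (1 : R) else 0) = if m = 0 then 1 else 0 :=
      if_congr (by omega) rfl rfl
    rw [hif, ← this]
    rw [← Finset.sum_image (f := fun c => h (a + c) * (zsign R (-c - b) * e (-c - b)))
      (fun y _ y' _ hy => mayaCol_injective k n hy)]
    symm
    -- Nonzero terms need `-a ≤ c ≤ -b`. Since `a < n` and `-k ≤ b`, this window lies inside the
    -- range `(-n, k]` of `mayaCol`, so the convolution is not truncated.
    refine Finset.sum_of_injOn (fun q => (q.1 : ℤ) - a) ?_ ?_ ?_ ?_
    · intro q hq q' hq' hqq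
      have h1 := Finset.HasAntidiagonal.mem_antidiagonal.1 hq
      have h2 := Finset.HasAntidiagonal.mem_antidiagonal.1 hq'
      simp only at hqq
      exact Prod.ext (by omega) (by omega)
    · intro q hq
      have h1 := Finset.HasAntidiagonal.mem_antidiagonal.1 hq
      obtain ⟨y, hy⟩ := exists_mayaCol_eq k n ((q.1 : ℤ) - a) (by omega) (by omega)
      simp only [Finset.coe_image, Finset.coe_univ, Set.image_univ]
      exact ⟨y, hy⟩
    · intro c _ hc
      rcases lt_or_ge (a + c) 0 with h1 | h1
      · rw [hneg _ h1, zero_mul]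
      rcases lt_or_ge (-c - b) 0 with h2 | h2
      · rw [eneg _ h2, mul_zero, mul_zero]
      exact absurd ⟨((a + c).toNat, (-c - b).toNat),
        Finset.HasAntidiagonal.mem_antidiagonal.2 (by simp only; omega), by simp only; omega⟩ hc
    · intro q hq
      have h1 := Finset.HasAntidiagonal.mem_antidiagonal.1 hq
      rw [show -((q.1 : ℤ) - a) - b = (q.2 : ℕ) by omega, zsign_natCast]
      simp

open Matrix in
/-- Duality of the halved symplectic determinant in the `h_n` and the orthogonal determinant of
the conjugate partition in the `e_n`. -/
theorem det_symplectic_eq_det_orthogonal (h e : ℤ → R) (h0 : h 0 = 1)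
    (hneg : ∀ z < 0, h z = 0) (eneg : ∀ z < 0, e z = 0)
    (rel : ∀ m : ℕ, ∑ q ∈ Finset.HasAntidiagonal.antidiagonal m, h q.1 * ((-1) ^ q.2 * e q.2) =
      if m = 0 then 1 else 0) (lam : YoungDiagram) (k n : ℕ)
    (hk : lam.colLen 0 ≤ k) (hn : lam.rowLen 0 ≤ n) :
    (of fun i j : Fin k => h ((lam.rowLen i : ℤ) - i + j) +
        if (j : ℕ) = 0 then 0 else h ((lam.rowLen i : ℤ) - i - j)).det =
      (of fun i j : Fin n => e ((lam.colLen i : ℤ) - i + j) -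
        e ((lam.colLen i : ℤ) - i - j - 2)).det := by
  have hTT := toeplitz_mul_eq_one h e hneg eneg rel lam k n hk hn
  have hdet := det_maya h h0 hneg k n lam hk hn
  set T : Matrix (Fin k ⊕ Fin n) (Fin k ⊕ Fin n) R :=
    of fun x y => h (maya lam k n x + mayaCol k n y) with hT
  set T' : Matrix (Fin k ⊕ Fin n) (Fin k ⊕ Fin n) R :=
    of fun y x => zsign R (-mayaCol k n y - maya lam k n x) *
      e (-mayaCol k n y - maya lam k n x) with hT'
  -- Right multiplication by the unipotent matrix adds the column with coordinate `-j` to the one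
  -- with coordinate `j + 2`; column `0` of the first block has no partner, which accounts for the
  -- halved first column.
  let Q : Matrix (Fin n) (Fin k) R := of fun j i => if (i : ℕ) = j + 1 then 1 else 0
  have hUV : fromBlocks 1 0 Q 1 * fromBlocks 1 0 (-Q) 1 = (1 : Matrix (Fin k ⊕ Fin n) (Fin k ⊕ Fin n) R) := by
    rw [fromBlocks_multiply]; simp
  have hMN : (T * fromBlocks 1 0 Q 1) * (fromBlocks 1 0 (-Q) 1 * T') = 1 := by
    rw [Matrix.mul_assoc, ← Matrix.mul_assoc (fromBlocks 1 0 Q 1), hUV, Matrix.one_mul, hTT]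
  have key := det_toBlocks₁₁_eq _ _ hMN
  rw [det_mul, hdet, det_fromBlocks_zero₁₂, det_one, det_one, mul_one, mul_one] at key
  have hM : (T * fromBlocks 1 0 Q 1).toBlocks₁₁ =
      of fun i j : Fin k => h ((lam.rowLen i : ℤ) - i + j) +
        if (j : ℕ) = 0 then 0 else h ((lam.rowLen i : ℤ) - i - j) := by
    ext i j
    have hi := maya_lt lam hn (Sum.inl i : Fin k ⊕ Fin n)
    simp only [maya, Sum.elim_inl] at hi
    simp only [toBlocks₁₁, of_apply, mul_apply, Fintype.sum_sum_type, fromBlocks_apply₁₁,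
      fromBlocks_apply₂₁, one_apply, mul_ite, mul_one, mul_zero, Finset.sum_ite_eq',
      Finset.mem_univ, if_true, hT, Q, maya, mayaCol, Sum.elim_inl, Sum.elim_inr]
    congr 1
    · congr 1; ring
    · split_ifs with hj
      · exact Finset.sum_eq_zero fun y _ => if_neg (by omega)
      · rcases lt_or_ge ((j : ℕ) - 1) n with hjn | hjn
        · rw [Finset.sum_eq_single ⟨(j : ℕ) - 1, hjn⟩]
          · rw [if_pos (by simp only; omega)]
            congr 1; simp only; omega
          · intro y _ hy
            exact if_neg fun hjy => hy (Fin.ext (by simp only; omega))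
          · simp
        -- The partner column lies outside the box, but its entry would have negative index.
        · rw [hneg _ (by omega)]
          exact Finset.sum_eq_zero fun y _ => if_neg (by omega)
  have hQ : ∀ j i, (-Q) j i = -(if (i : ℕ) = j + 1 then 1 else 0) := fun _ _ => rfl
  -- The sign exponents of both `e` terms have the parity of `j + (i + lam.colLen i)`, so the signs
  -- split into row and column factors.
  have hN : (fromBlocks 1 0 (-Q) 1 * T').toBlocks₂₂ =
      diagonal (fun j : Fin n => zsign R j) * ((of fun i j : Fin n =>
        e ((lam.colLen i : ℤ) - i + j) - e ((lam.colLen i : ℤ) - i - j - 2))ᵀ *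
        diagonal (fun i : Fin n => zsign R ((i : ℤ) + lam.colLen i))) := by
    ext j i
    have hi := neg_le_maya lam hk (Sum.inr i : Fin k ⊕ Fin n)
    simp only [maya, Sum.elim_inr] at hi
    rw [diagonal_mul, mul_diagonal]
    simp only [toBlocks₂₂, of_apply, mul_apply, Fintype.sum_sum_type, fromBlocks_apply₂₂,
      fromBlocks_apply₂₁, one_apply, ite_mul, one_mul, zero_mul, Finset.sum_ite_eq,
      Finset.mem_univ, if_true, hT', hQ, maya, mayaCol, Sum.elim_inl, Sum.elim_inr,
      neg_mul, transpose_apply, Finset.sum_neg_distrib]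
    have e1 : (∑ y : Fin k, if (y : ℕ) = j + 1 then
        zsign R (-((y : ℤ) + 1) - (i - lam.colLen i)) * e (-((y : ℤ) + 1) - (i - lam.colLen i))
        else 0) = zsign R (-(j + 2 : ℤ) - (i - lam.colLen i)) *
          e (-(j + 2 : ℤ) - (i - lam.colLen i)) := by
      rcases lt_or_ge ((j : ℕ) + 1) k with hjk | hjk
      · rw [Finset.sum_eq_single ⟨(j : ℕ) + 1, hjk⟩]
        · rw [if_pos rfl]
          simp only [Nat.cast_add, Nat.cast_one, add_assoc, one_add_one_eq_two]
        · intro y _ hy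
          exact if_neg fun hjy => hy (Fin.ext hjy)
        · simp
      · rw [eneg _ (by omega), mul_zero]
        exact Finset.sum_eq_zero fun y _ => if_neg (by omega)
    rw [e1]
    have e2 : - -(j : ℤ) - (i - lam.colLen i) = (lam.colLen i : ℤ) - i + j := by ring
    have e3 : -(j + 2 : ℤ) - (i - lam.colLen i) = (lam.colLen i : ℤ) - i - j - 2 := by ring
    have e4 : (lam.colLen i : ℤ) - i + j = j + (i + lam.colLen i) + 2 * (-i) := by ring
    have e5 : (lam.colLen i : ℤ) - i - j - 2 = j + (i + lam.colLen i) + 2 * (-i - j - 1) := by ring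
    have s1 : zsign R ((lam.colLen i : ℤ) - i + j) = zsign R j * zsign R (i + lam.colLen i) := by
      rw [e4, zsign_add, zsign_two_mul, mul_one, zsign_add]
    have s2 : zsign R ((lam.colLen i : ℤ) - i - j - 2) =
        zsign R j * zsign R (i + lam.colLen i) := by
      rw [e5, zsign_add, zsign_two_mul, mul_one, zsign_add]
    rw [e2, e3, s1, s2]
    ring
  rw [hM, hN, det_mul, det_mul, det_transpose, det_diagonal, det_diagonal] at key
  rw [key]
  simp only [zsign_add, Finset.prod_mul_distrib]
  have hs1 : (∏ i : Fin n, zsign R i) * ∏ i : Fin n, zsign R i = 1 := by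
    rw [← Finset.prod_mul_distrib]
    exact Finset.prod_eq_one fun i _ => zsign_mul_self _
  have hs2 : ∏ i : Fin n, zsign R (lam.colLen i) = (-1) ^ lam.cells.card := by
    simp only [zsign_natCast]
    rw [Finset.prod_pow_eq_pow_sum, card_cells_eq_sum_colLen lam hn]
  have hs3 : (-1 : R) ^ lam.cells.card * (-1) ^ lam.cells.card = 1 := by
    rw [← mul_pow]; simp
  rw [hs2]
  generalize (-1 : R) ^ lam.cells.card = s at *
  generalize (∏ i : Fin n, zsign R (i : ℤ)) = u at *
  linear_combination (of fun i j : Fin n => e ((lam.colLen i : ℤ) - i + j) -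
        e ((lam.colLen i : ℤ) - i - j - 2)).det * (s * s * hs1 + hs3)

end
end SymFun

/-! ### Newton's identities and the given determinants. -/

noncomputable section
namespace SymFun
open MvPowerSeries

theorem neg_one_pow_mul_self {R : Type*} [CommRing R] (n : ℕ) : (-1 : R) ^ n * (-1) ^ n = 1 := by
  rw [← mul_pow]; simp

theorem half_smul_two_mul {R : Type*} [CommRing R] [Algebra ℚ R] (x : R) :
    (1 / 2 : ℚ) • (2 * x) = x := by
  rw [two_mul, ← two_smul ℚ, smul_smul]; norm_num

/-- Newton's identity `n h_n = ∑_{i + j = n, i ≥ 1} p_i h_j`. -/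
theorem newton_h (n : ℕ) : ((n + 1 : ℕ) : symmetricFunctions) * h ((n + 1 : ℕ) : ℤ) =
    ∑ q ∈ Finset.HasAntidiagonal.antidiagonal n, p (q.1 + 1) * h (q.2 : ℤ) := by
  rw [Finset.Nat.sum_antidiagonal_eq_sum_range_succ (fun i j => p (i + 1) * h (j : ℤ))]
  refine Subtype.ext (MvPowerSeries.ext fun m => ?_)
  have hL : (((n + 1 : ℕ) : symmetricFunctions) * h ((n + 1 : ℕ) : ℤ)).1 =
      (n + 1) • hseries (n + 1) := by
    rw [← nsmul_eq_mul]; rfl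
  have hR : (∑ k ∈ Finset.range n.succ, p (k + 1) * h ((n - k : ℕ) : ℤ)).1 =
      ∑ k ∈ Finset.range n.succ, pseries (k + 1) * hseries (n - k) := by
    rw [AddSubmonoidClass.coe_finsetSum]; rfl
  rw [hL, hR, map_nsmul, map_sum, coeff_hseries]
  simp only [coeff_pseries_mul _ (Nat.le_add_left 1 _), coeff_hseries]
  have hdeg : ∀ i k, k + 1 ≤ m i →
      (m - Finsupp.single i (k + 1)).degree + (k + 1) = m.degree := fun i k hk => by
    conv_rhs => rw [← tsub_add_cancel_of_le (Finsupp.single_le_iff.2 hk), map_add,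
      Finsupp.degree_single]
  split_ifs with hm
  · have h1 : ∀ k ∈ Finset.range n.succ, (∑ i ∈ m.support with k + 1 ≤ m i,
        if (m - Finsupp.single i (k + 1)).degree = n - k then (1 : ℚ) else 0) =
        ∑ i ∈ m.support, if k < m i then 1 else 0 := fun k hk => by
      rw [Finset.sum_filter]
      refine Finset.sum_congr rfl fun i _ => ?_
      rcases lt_or_ge k (m i) with hki | hki
      · have := hdeg i k hki
        rw [if_pos (Nat.succ_le_of_lt hki), if_pos hki, if_pos (by omega)]
      · rw [if_neg (by omega), if_neg (by omega)]
    -- Double counting: variable `i` contributes once for each `k < m i`, so the total is the degree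
    -- of `m`.
    rw [Finset.sum_congr rfl h1, Finset.sum_comm]
    have h2 : ∀ i ∈ m.support,
        (∑ k ∈ Finset.range n.succ, if k < m i then (1 : ℚ) else 0) = m i := fun i _ => by
      have hi := Finsupp.le_degree i m
      rw [← Finset.sum_filter, show (Finset.range n.succ).filter (· < m i) = Finset.range (m i) by
        ext; simp; omega]
      simp
    rw [Finset.sum_congr rfl h2, ← Nat.cast_sum, nsmul_eq_mul, mul_one, ← hm,
      Finsupp.degree_apply]
  · rw [smul_zero]
    symm
    refine Finset.sum_eq_zero fun k hk => Finset.sum_eq_zero fun i hi => if_neg fun hc => hm ?_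
    have := hdeg i k (Finset.mem_filter.1 hi).2
    have := Finset.mem_range.1 hk
    omega

theorem h_zero : h 0 = 1 := by
  refine Subtype.ext (MvPowerSeries.ext fun m => ?_)
  classical
  change coeff m (hseries 0) = coeff m 1
  rw [coeff_hseries, coeff_one]
  simp [Finsupp.degree_eq_zero_iff]

theorem h_of_neg (z : ℤ) (hz : z < 0) : h z = 0 := by
  obtain ⟨n, rfl⟩ := Int.eq_negSucc_of_lt_zero hz
  rfl

/-- An endomorphism changing the sign of the even power sums maps the `h_n` to the coefficients
`e_n` of the power series with `E(-t) H(t) = 1`. -/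
theorem sum_h_mul_omega_h (ω : symmetricFunctions →ₐ[ℚ] symmetricFunctions)
    (hω : ∀ n : ℕ, 1 ≤ n → ω (p n) = (-1) ^ (n - 1) * p n) (m : ℕ) :
    ∑ q ∈ Finset.HasAntidiagonal.antidiagonal m, h q.1 * ((-1) ^ q.2 * ω (h q.2)) =
      if m = 0 then 1 else 0 := by
  have : IsAddTorsionFree symmetricFunctions := IsAddTorsionFree.of_module_rat _
  let H : PowerSeries symmetricFunctions := PowerSeries.mk fun n => h (n : ℤ)
  let F : PowerSeries symmetricFunctions := PowerSeries.mk fun n => (-1) ^ n * ω (h (n : ℤ))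
  let P : PowerSeries symmetricFunctions := PowerSeries.mk fun n => p (n + 1)
  have hH : PowerSeries.derivative symmetricFunctions H = P * H := by
    ext1 n
    rw [PowerSeries.coeff_derivative, PowerSeries.coeff_mul]
    simp only [H, P, PowerSeries.coeff_mk]
    rw [← newton_h, mul_comm]
    push_cast
    rfl
  have hF : PowerSeries.derivative symmetricFunctions F = -(P * F) := by
    ext1 n
    rw [PowerSeries.coeff_derivative, map_neg, PowerSeries.coeff_mul]
    simp only [F, P, PowerSeries.coeff_mk]
    have h1 := congrArg ω (newton_h n)
    rw [map_mul, map_natCast, map_sum] at h1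
    have h2 : (-1) ^ (n + 1) * ω (h ((n + 1 : ℕ) : ℤ)) * ((n : symmetricFunctions) + 1) =
        (-1) ^ (n + 1) * (((n + 1 : ℕ) : symmetricFunctions) * ω (h ((n + 1 : ℕ) : ℤ))) := by
      push_cast; ring
    rw [h2, h1, Finset.mul_sum, ← Finset.sum_neg_distrib]
    refine Finset.sum_congr rfl fun q hq => ?_
    rw [map_mul, hω _ (Nat.le_add_left 1 _), Nat.add_sub_cancel,
      ← Finset.HasAntidiagonal.mem_antidiagonal.1 hq]
    have h3 : ((-1 : symmetricFunctions) ^ q.1) * (-1) ^ q.1 = 1 :=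
      neg_one_pow_mul_self q.1
    rw [pow_succ, pow_add]
    linear_combination (-(-1) ^ q.2 * p (q.1 + 1) * ω (h (q.2 : ℤ))) * h3
  have hHF : H * F = 1 := by
    -- `(H F)' = H (-P F) + F (P H) = 0` and the constant term is `1`; torsion-freeness makes this
    -- determine `H F`.
    refine PowerSeries.derivative.ext ?_ ?_
    · rw [Derivation.leibniz, hH, hF, smul_eq_mul, smul_eq_mul, Derivation.map_one_eq_zero]
      ring
    · rw [map_mul, map_one, ← PowerSeries.coeff_zero_eq_constantCoeff_apply,
        ← PowerSeries.coeff_zero_eq_constantCoeff_apply]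
      simp [H, F, h_zero]
  have := congrArg (PowerSeries.coeff m) hHF
  rw [PowerSeries.coeff_mul, PowerSeries.coeff_one] at this
  simpa only [H, F, PowerSeries.coeff_mk] using this

/-- In the first column the two summands coincide, so a factor `2` comes out and cancels the `1/2`.
The empty determinant covers the empty partition, where no such column exists. -/
theorem sp_eq_det (lam : YoungDiagram) : sp lam =
    (Matrix.of fun i j : Fin (lam.colLen 0) => h ((lam.rowLen i : ℤ) - i + j) +
      if (j : ℕ) = 0 then 0 else h ((lam.rowLen i : ℤ) - i - j)).det := by
  unfold sp
  split_ifs with h0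
  · have : IsEmpty (Fin (lam.colLen 0)) := by rw [h0]; infer_instance
    rw [Matrix.det_isEmpty]
  · generalize lam.colLen 0 = k at *
    obtain ⟨k, rfl⟩ := Nat.exists_eq_succ_of_ne_zero h0
    set A : Matrix (Fin (k + 1)) (Fin (k + 1)) symmetricFunctions :=
      Matrix.of fun i j => h ((lam.rowLen i : ℤ) - i + j) +
        if (j : ℕ) = 0 then 0 else h ((lam.rowLen i : ℤ) - i - j) with hA
    have hM : (Matrix.of fun i j : Fin (k + 1) =>
        h ((lam.rowLen i : ℤ) - ((i : ℤ) + 1) + ((j : ℤ) + 1)) +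
          h ((lam.rowLen i : ℤ) - ((i : ℤ) + 1) - ((j : ℤ) + 1) + 2)) =
        A.updateCol 0 ((2 : symmetricFunctions) • fun i => A i 0) := by
      ext1 i j
      rw [Matrix.updateCol_apply]
      have e1 : (lam.rowLen i : ℤ) - ((i : ℤ) + 1) + ((j : ℤ) + 1) = lam.rowLen i - i + j := by
        ring
      have e2 : (lam.rowLen i : ℤ) - ((i : ℤ) + 1) - ((j : ℤ) + 1) + 2 =
        lam.rowLen i - i - j := by ring
      simp only [Matrix.of_apply, hA, e1, e2]
      by_cases hj : j = 0
      · subst hj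
        simp [two_mul]
      · rw [if_neg hj, if_neg fun hj' : (j : ℕ) = 0 => hj (Fin.ext hj')]
    rw [hM, Matrix.det_updateCol_smul, show (fun i => A i 0) = fun i => A.col 0 i from rfl]
    have : A.updateCol 0 (fun i => A.col 0 i) = A := Matrix.updateCol_eq_self A 0
    rw [this]
    exact half_smul_two_mul _

theorem o_transpose_eq_det (lam : YoungDiagram) : o lam.transpose =
    (Matrix.of fun i j : Fin (lam.rowLen 0) => h ((lam.colLen i : ℤ) - i + j) -
      h ((lam.colLen i : ℤ) - i - j - 2)).det := by
  unfold o
  simp only [YoungDiagram.rowLen_transpose]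
  rw [show lam.transpose.colLen 0 = lam.rowLen 0 from lam.colLen_transpose 0]
  congr 1
  ext1 i j
  simp only [Matrix.of_apply]
  congr 2 <;> ring

end SymFun
end

/-- There is a unique `ℚ`-algebra endomorphism `ω` of the ring of symmetric functions with
`ω(p_n) = (-1)^(n-1) p_n` for all `n ≥ 1`; it is an involution, and it sends the universal
symplectic Schur function of every partition to the universal orthogonal Schur function of the
conjugate partition. -/
theorem mainTheorem1 :
    ∃ ω : SymFun.symmetricFunctions →ₐ[ℚ] SymFun.symmetricFunctions,
      (∀ n : ℕ, 1 ≤ n → ω (SymFun.p n) = (-1) ^ (n - 1) * SymFun.p n) ∧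
      (∀ ω' : SymFun.symmetricFunctions →ₐ[ℚ] SymFun.symmetricFunctions,
        (∀ n : ℕ, 1 ≤ n → ω' (SymFun.p n) = (-1) ^ (n - 1) * SymFun.p n) → ω' = ω) ∧
      (∀ f : SymFun.symmetricFunctions, ω (ω f) = f) ∧
      ∀ lam : YoungDiagram, ω (SymFun.sp lam) = SymFun.o lam.transpose := by
  let q : ℕ → SymFun.symmetricFunctions := fun k => SymFun.p (k + 1)
  have hbij : Function.Bijective (MvPolynomial.aeval (R := ℚ) q) := by
    refine ⟨SymFun.algebraicIndependent_p, ?_⟩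
    rw [← AlgHom.range_eq_top, ← Algebra.adjoin_range_eq_range_aeval]
    exact SymFun.adjoin_p_eq_top
  let Φ := AlgEquiv.ofBijective _ hbij
  have ext_p : ∀ f g : SymFun.symmetricFunctions →ₐ[ℚ] SymFun.symmetricFunctions,
      (∀ k, f (SymFun.p (k + 1)) = g (SymFun.p (k + 1))) → f = g := fun f g hfg => by
    refine AlgHom.ext_of_adjoin_eq_top SymFun.adjoin_p_eq_top ?_
    rintro _ ⟨k, rfl⟩
    exact hfg k
  let ω : SymFun.symmetricFunctions →ₐ[ℚ] SymFun.symmetricFunctions :=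
    (MvPolynomial.aeval fun k => (-1) ^ k * SymFun.p (k + 1)).comp
      (Φ.symm : SymFun.symmetricFunctions →ₐ[ℚ] MvPolynomial ℕ ℚ)
  have hω' : ∀ k, ω (SymFun.p (k + 1)) = (-1) ^ k * SymFun.p (k + 1) := fun k => by
    have hk : Φ.symm (SymFun.p (k + 1)) = MvPolynomial.X k := by
      rw [AlgEquiv.symm_apply_eq]
      exact (MvPolynomial.aeval_X q k).symm
    change MvPolynomial.aeval _ (Φ.symm (SymFun.p (k + 1))) = _
    rw [hk, MvPolynomial.aeval_X]
  have hω : ∀ n : ℕ, 1 ≤ n → ω (SymFun.p n) = (-1) ^ (n - 1) * SymFun.p n := fun n hn => by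
    obtain ⟨k, rfl⟩ := Nat.exists_eq_add_of_le' hn
    exact hω' k
  have hinv : ω.comp ω = AlgHom.id ℚ _ := ext_p _ _ fun k => by
    rw [AlgHom.comp_apply, hω', map_mul, map_pow, map_neg, map_one, hω', ← mul_assoc,
      SymFun.neg_one_pow_mul_self, one_mul]
    rfl
  have hωω : ∀ f, ω (ω f) = f := fun f => DFunLike.congr_fun hinv f
  refine ⟨ω, hω, fun ω' h' => ext_p _ _ fun k => ?_, hωω, fun lam => ?_⟩
  · rw [h' _ (Nat.le_add_left 1 k), hω _ (Nat.le_add_left 1 k)]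
  · rw [SymFun.sp_eq_det, SymFun.o_transpose_eq_det, AlgHom.map_det]
    -- The duality is used with `ω(h_n)` in the role of `h` and `h_n` in the role of `e`; the
    -- required relation is the image under `ω` of the one for `h_n` and `ω(h_n)`, by involutivity.
    rw [← SymFun.det_symplectic_eq_det_orthogonal (fun z => ω (SymFun.h z)) SymFun.h
      (by rw [SymFun.h_zero, map_one]) (fun z hz => by rw [SymFun.h_of_neg z hz, map_zero])
      SymFun.h_of_neg (fun m => ?_) lam _ _ le_rfl le_rfl]
    · congr 1
      ext1 i j
      simp only [AlgHom.mapMatrix_apply, Matrix.map_apply, Matrix.of_apply, map_add]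
      split_ifs <;> simp
    · have := congrArg ω (SymFun.sum_h_mul_omega_h ω hω m)
      rw [map_sum, apply_ite ω, map_one, map_zero] at this
      rw [← this]
      refine Finset.sum_congr rfl fun r _ => ?_
      rw [map_mul, map_mul, map_pow, map_neg, map_one, hωω]
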